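/- Let $K$ be a commutative ring and let $R$ be a unital associative $K$-algebra (for $K=\mathbb{Z}$: an arbitrary unital ring). Suppose that $R$ is semiprime (that is, $aRa=0$ implies $a=0$ for $a\in R$) and left Goldie (that is, $R$ contains no infinite direct sum of nonzero left ideals and satisfies the ascending chain condition on left annihilators of subsets). Let ${\cal C}_R$ be the set of regular elements of $R$, i.e. the elements $c\in R$ such that for all $x\in R$, $cx=0$ implies $x=0$ and $xc=0$ implies $x=0$. A subset $S\subseteq R$ is called an Ore set of $R$ if it is multiplicative ($1\in S$, $SS\subseteq S$, $0\notin S$) and $Sr\cap Rs\neq\emptyset$ and $rS\cap sR\neq\emptyset$ for all $r\in R$ and $s\in S$. For a multiplicative set $S$, let $R\langle X_S\rangle$ be the $K$-algebra freely generated by the $K$-algebra $R$ and the set $X_S=\{x_s\mid s\in S\}$ of noncommuting indeterminates, let $I_S$ be its two-sided ideal generated by the elements $sx_s-1$ and $x_ss-1$ for $s\in S$, and let $R\langle S^{-1}\rangle=R\langle X_S\rangle/I_S$. Denote by ${\rm ass}_R(S)$ the kernel of the ring homomorphism $R\to R\langle S^{-1}\rangle$, $r\mapsto r+I_S$. Then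 ${\cal C}_R\cap {\rm ass}_R(S)=\emptyset$ for every Ore set $S$ of $R$. -/

import Mathlib

/-- A ring is semiprime if `a R a = 0` implies `a = 0`. -/
def IsSemiprimeRing (R : Type*) [Ring R] : Prop :=
  ∀ a : R, (∀ r : R, a * r * a = 0) → a = 0

/-- The left annihilator `{r | r x = 0 for all x ∈ X}` of a subset `X` of a ring, a left ideal. -/
def leftAnnihilator {R : Type*} [Ring R] (X : Set R) : Submodule R R where
  carrier := {r | ∀ x ∈ X, r * x = 0}
  add_mem' := by
    intro a b ha hb x hx
    rw [add_mul, ha x hx, hb x hx, add_zero]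
  zero_mem' := by
    intro x _
    exact zero_mul x
  smul_mem' := by
    intro c a ha x hx
    rw [smul_eq_mul, mul_assoc, ha x hx, mul_zero]

/-- A left Goldie ring: it contains no infinite direct sum of nonzero left ideals (that is, its
left uniform dimension is finite), and every ascending chain of left annihilators of subsets
stabilizes. -/
structure IsLeftGoldieRing (R : Type*) [Ring R] : Prop where
  finite_udim : ∀ I : ℕ → Submodule R R, iSupIndep I → ∃ n, I n = ⊥
  acc_leftAnnihilator : ∀ X : ℕ → Set R, Monotone (fun n => leftAnnihilator (X n)) →
    ∃ n, ∀ m, n ≤ m → leftAnnihilator (X m) = leftAnnihilator (X n)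

/-- An Ore set of a ring: a multiplicative set (a submonoid that does not contain `0`) which
satisfies the left Ore condition `S r ∩ R s ≠ ∅` and the right Ore condition `r S ∩ s R ≠ ∅`
for all `r ∈ R` and `s ∈ S`. -/
structure IsOreSet {R : Type*} [Ring R] (S : Submonoid R) : Prop where
  zero_notMem : (0 : R) ∉ S
  left_ore : ∀ r : R, ∀ s ∈ S, ∃ s' ∈ S, ∃ r' : R, s' * r = r' * s
  right_ore : ∀ r : R, ∀ s ∈ S, ∃ s' ∈ S, ∃ r' : R, r * s' = s * r'

/-- The relations which say that the generators `Sum.inl r`, `r ∈ R`, form a copy of the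
`K`-algebra `R`. The generators `Sum.inr x`, `x ∈ X`, are subject to no relation. -/
inductive FreeExtensionRel (K R X : Type*) [CommRing K] [Ring R] [Algebra K R] :
    FreeAlgebra K (R ⊕ X) → FreeAlgebra K (R ⊕ X) → Prop
  | add (a b : R) : FreeExtensionRel K R X (FreeAlgebra.ι K (Sum.inl (a + b)))
      (FreeAlgebra.ι K (Sum.inl a) + FreeAlgebra.ι K (Sum.inl b))
  | mul (a b : R) : FreeExtensionRel K R X (FreeAlgebra.ι K (Sum.inl (a * b)))
      (FreeAlgebra.ι K (Sum.inl a) * FreeAlgebra.ι K (Sum.inl b))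
  | algebraMap (k : K) : FreeExtensionRel K R X
      (FreeAlgebra.ι K (Sum.inl (algebraMap K R k))) (algebraMap K (FreeAlgebra K (R ⊕ X)) k)

/-- `R⟨X⟩`, the `K`-algebra freely generated by the `K`-algebra `R` and a set `X` of
noncommutative indeterminates. -/
abbrev FreeExtension (K R X : Type*) [CommRing K] [Ring R] [Algebra K R] :=
  RingQuot (FreeExtensionRel K R X)

/-- The canonical homomorphism `R → R⟨X⟩`. -/
noncomputable def FreeExtension.incl (K R X : Type*) [CommRing K] [Ring R] [Algebra K R] :
    R →ₐ[K] FreeExtension K R X :=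
  AlgHom.ofLinearMap
    { toFun := fun r => RingQuot.mkAlgHom K (FreeExtensionRel K R X) (FreeAlgebra.ι K (Sum.inl r))
      map_add' := fun a b => by
        rw [RingQuot.mkAlgHom_rel K (FreeExtensionRel.add a b), map_add]
      map_smul' := fun k a => by
        rw [Algebra.smul_def, RingQuot.mkAlgHom_rel K (FreeExtensionRel.mul _ a), map_mul,
          RingQuot.mkAlgHom_rel K (FreeExtensionRel.algebraMap k), AlgHom.commutes,
          RingHom.id_apply, Algebra.smul_def] }
    (by
      have h := RingQuot.mkAlgHom_rel K (FreeExtensionRel.algebraMap (K := K) (R := R) (X := X) 1)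
      simpa using h)
    (fun a b => by
      have h := RingQuot.mkAlgHom_rel K (FreeExtensionRel.mul (K := K) (X := X) a b)
      simpa using h)

/-- The indeterminate of `R⟨X⟩` with index `x`. -/
noncomputable def FreeExtension.var (K R : Type*) {X : Type*} [CommRing K] [Ring R] [Algebra K R]
    (x : X) : FreeExtension K R X :=
  RingQuot.mkAlgHom K (FreeExtensionRel K R X) (FreeAlgebra.ι K (Sum.inr x))

/-- The ideal `I_S` of `R⟨X_S⟩` generated by all `s x_s - 1` and `x_s s - 1` with `s ∈ S`. -/
noncomputable def inverseIdeal (K : Type*) {R : Type*} [CommRing K] [Ring R] [Algebra K R]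
    (S : Submonoid R) : TwoSidedIdeal (FreeExtension K R S) :=
  TwoSidedIdeal.span
    ({y | ∃ s : S, y = FreeExtension.incl K R S (s : R) * FreeExtension.var K R s - 1} ∪
      {y | ∃ s : S, y = FreeExtension.var K R s * FreeExtension.incl K R S (s : R) - 1})

/-- The ring `R⟨S⁻¹⟩ = R⟨X_S⟩ / I_S`. -/
abbrev UniversalLocalization (K : Type*) {R : Type*} [CommRing K] [Ring R] [Algebra K R]
    (S : Submonoid R) :=
  (inverseIdeal K S).ringCon.Quotient

/-- The canonical homomorphism `R → R⟨S⁻¹⟩`, `r ↦ r + I_S`. -/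
noncomputable def toUniversalLocalization (K : Type*) {R : Type*} [CommRing K] [Ring R]
    [Algebra K R] (S : Submonoid R) : R →ₐ[K] UniversalLocalization K S :=
  ((inverseIdeal K S).ringCon.mkₐ K).comp (FreeExtension.incl K R S)

/-- The ideal `ass_R(S)`, the kernel of `R → R⟨S⁻¹⟩`. -/
noncomputable def assIdeal (K : Type*) {R : Type*} [CommRing K] [Ring R] [Algebra K R]
    (S : Submonoid R) : TwoSidedIdeal R :=
  TwoSidedIdeal.ker (toUniversalLocalization K S)

/-!
If `S` satisfies the left Ore condition and the chain `l.ann(s) ⊆ l.ann(s²) ⊆ ⋯` of left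
annihilators stabilizes for every `s ∈ S`, then `S` is left reversible. Indeed, let `a s = 0` and
`l.ann(sⁿ⁺¹) = l.ann(sⁿ)`, and write `t a = b sⁿ` with `t ∈ S`. Then `b sⁿ⁺¹ = t a s = 0`, hence
`t a = b sⁿ = 0`. So the Ore localization `S⁻¹R` exists, and `R → S⁻¹R` factors through
`R⟨S⁻¹⟩` because it inverts `S`. Therefore every element of `ass_R(S)` is killed from the left by
an element of `S`, and a regular element is killed only by `0`, which is not in `S`.
-/

section UniversalProperty

variable {K R T : Type*} [CommRing K] [Ring R] [Algebra K R] [Ring T] [Algebra K T]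

namespace FreeExtension

variable {X : Type*}

/-- The universal property of `R⟨X⟩`: the algebra homomorphism `R⟨X⟩ → T` which extends
`f : R → T` and sends the indeterminate with index `x` to `g x`. -/
noncomputable def lift (f : R →ₐ[K] T) (g : X → T) : FreeExtension K R X →ₐ[K] T :=
  RingQuot.liftAlgHom K ⟨FreeAlgebra.lift K (Sum.elim f g), by
    rintro _ _ (⟨a, b⟩ | ⟨a, b⟩ | ⟨k⟩) <;> simp⟩

@[simp]
theorem lift_incl (f : R →ₐ[K] T) (g : X → T) (r : R) : lift f g (incl K R X r) = f r :=
  (RingQuot.liftAlgHom_mkAlgHom_apply K _ _ _).trans (by simp)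

@[simp]
theorem lift_var (f : R →ₐ[K] T) (g : X → T) (x : X) : lift f g (var K R x) = g x :=
  (RingQuot.liftAlgHom_mkAlgHom_apply K _ _ _).trans (by simp)

end FreeExtension

variable {S : Submonoid R}

theorem mem_assIdeal_iff {a : R} :
    a ∈ assIdeal K S ↔ FreeExtension.incl K R S a ∈ inverseIdeal K S := by
  rw [assIdeal, TwoSidedIdeal.mem_ker, TwoSidedIdeal.mem_iff]
  exact RingCon.eq _

theorem inverseIdeal_le_ker_lift (f : R →ₐ[K] T) (u : S → Tˣ) (hu : ∀ s, (u s : T) = f s) :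
    inverseIdeal K S ≤ TwoSidedIdeal.ker (FreeExtension.lift f fun s => ((u s)⁻¹ : Tˣ).val) := by
  refine TwoSidedIdeal.span_le.2 ?_
  rintro _ (⟨s, rfl⟩ | ⟨s, rfl⟩) <;> simp [TwoSidedIdeal.mem_ker, ← hu]

theorem assIdeal_le_ker (f : R →ₐ[K] T) (hf : ∀ s ∈ S, IsUnit (f s)) :
    assIdeal K S ≤ TwoSidedIdeal.ker f := by
  intro a ha
  choose u hu using fun s : S => hf s s.2
  have hlift := inverseIdeal_le_ker_lift f u hu (mem_assIdeal_iff.1 ha)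
  rw [TwoSidedIdeal.mem_ker] at hlift ⊢
  rwa [FreeExtension.lift_incl] at hlift

end UniversalProperty

section LeftAnnihilator

variable {R : Type*} [Ring R]

theorem mem_leftAnnihilator_singleton {r x : R} : r ∈ leftAnnihilator {x} ↔ r * x = 0 :=
  forall_eq

theorem monotone_leftAnnihilator_pow (s : R) : Monotone fun n : ℕ => leftAnnihilator {s ^ n} := by
  refine monotone_nat_of_le_succ fun n r hr => ?_
  rw [mem_leftAnnihilator_singleton] at hr ⊢
  rw [pow_succ, ← mul_assoc, hr, zero_mul]

theorem IsLeftGoldieRing.exists_leftAnnihilator_pow_succ_le (hG : IsLeftGoldieRing R) (s : R) :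
    ∃ n : ℕ, leftAnnihilator {s ^ (n + 1)} ≤ leftAnnihilator {s ^ n} :=
  let ⟨n, hn⟩ := hG.acc_leftAnnihilator _ (monotone_leftAnnihilator_pow s)
  ⟨n, (hn (n + 1) n.le_succ).le⟩

end LeftAnnihilator

section OreCondition

variable {R : Type*} [Ring R] {S : Submonoid R}

theorem exists_mul_eq_zero_of_mul_eq_zero
    (left_ore : ∀ r : R, ∀ s ∈ S, ∃ s' ∈ S, ∃ r' : R, s' * r = r' * s) {s : R} (hs : s ∈ S) {n : ℕ}
    (hn : leftAnnihilator {s ^ (n + 1)} ≤ leftAnnihilator {s ^ n}) {a : R} (has : a * s = 0) :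
    ∃ t ∈ S, t * a = 0 := by
  obtain ⟨t, ht, b, htab⟩ := left_ore a (s ^ n) (pow_mem hs n)
  have hb : b * s ^ (n + 1) = 0 := by
    rw [pow_succ, ← mul_assoc, ← htab, mul_assoc, has, mul_zero]
  exact ⟨t, ht, htab.trans (mem_leftAnnihilator_singleton.1
    (hn (mem_leftAnnihilator_singleton.2 hb)))⟩

theorem nonempty_oreSet_of_leftAnnihilator_pow_succ_le
    (left_ore : ∀ r : R, ∀ s ∈ S, ∃ s' ∈ S, ∃ r' : R, s' * r = r' * s)
    (hann : ∀ s ∈ S, ∃ n : ℕ, leftAnnihilator {s ^ (n + 1)} ≤ leftAnnihilator {s ^ n}) :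
    Nonempty (OreLocalization.OreSet S) := by
  refine OreLocalization.nonempty_oreSet_iff.2 ⟨fun a b s hab => ?_, fun r s => ?_⟩
  · obtain ⟨n, hn⟩ := hann s s.2
    have hsub : (a - b) * s = 0 := by rw [sub_mul, hab, sub_self]
    obtain ⟨t, ht, htab⟩ := exists_mul_eq_zero_of_mul_eq_zero left_ore s.2 hn hsub
    exact ⟨⟨t, ht⟩, sub_eq_zero.1 (by rwa [← mul_sub])⟩
  · obtain ⟨s', hs', r', h⟩ := left_ore r s s.2
    exact ⟨r', ⟨s', hs'⟩, h⟩

end OreCondition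

section OreLocalization

theorem numeratorRingHom_eq_zero_iff {R : Type*} [Semiring R] {S : Submonoid R}
    [OreLocalization.OreSet S] {r : R} :
    (OreLocalization.numeratorRingHom r : OreLocalization S R) = 0 ↔ ∃ s ∈ S, s * r = 0 := by
  change OreLocalization.oreDiv r (1 : S) = 0 ↔ _
  rw [OreLocalization.zero_def, OreLocalization.oreDiv_eq_iff]
  constructor
  · rintro ⟨u, v, hur, huv⟩
    have hv : (u : R) = v := by simpa using huv
    exact ⟨u, u.2, by simpa [hv] using hur.symm⟩
  · rintro ⟨s, hs, hsr⟩
    exact ⟨⟨s, hs⟩, s, by simp [hsr], rfl⟩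

theorem exists_mul_eq_zero_of_mem_assIdeal {K R : Type*} [CommRing K] [Ring R] [Algebra K R]
    {S : Submonoid R} [OreLocalization.OreSet S] {a : R} (ha : a ∈ assIdeal K S) :
    ∃ s ∈ S, s * a = 0 := by
  let numeratorAlgHom : R →ₐ[K] OreLocalization S R :=
    { OreLocalization.numeratorRingHom with commutes' := fun _ => rfl }
  have hunit : ∀ s ∈ S, IsUnit (numeratorAlgHom s) := fun s hs =>
    OreLocalization.numerator_isUnit ⟨s, hs⟩
  exact numeratorRingHom_eq_zero_iff.1
    ((TwoSidedIdeal.mem_ker _).1 (assIdeal_le_ker numeratorAlgHom hunit ha))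

end OreLocalization

theorem mainTheorem8_general {K R : Type*} [CommRing K] [Ring R] [Algebra K R] {S : Submonoid R}
    (zero_notMem : (0 : R) ∉ S)
    (left_ore : ∀ r : R, ∀ s ∈ S, ∃ s' ∈ S, ∃ r' : R, s' * r = r' * s)
    (hann : ∀ s ∈ S, ∃ n : ℕ, leftAnnihilator {s ^ (n + 1)} ≤ leftAnnihilator {s ^ n}) :
    Disjoint (nonZeroDivisorsRight R : Set R) (assIdeal K S : Set R) := by
  refine Set.disjoint_left.2 fun c hc hca => zero_notMem ?_
  obtain ⟨_⟩ := nonempty_oreSet_of_leftAnnihilator_pow_succ_le left_ore hann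
  obtain ⟨s, hs, hsc⟩ := exists_mul_eq_zero_of_mem_assIdeal (K := K) hca
  rwa [hc s hsc] at hs

theorem mainTheorem8 {K R : Type*} [CommRing K] [Ring R] [Algebra K R]
    (hsp : IsSemiprimeRing R) (hG : IsLeftGoldieRing R) (S : Submonoid R) (hS : IsOreSet S) :
    (nonZeroDivisors R : Set R) ∩ (assIdeal K S : Set R) = ∅ :=
  ((mainTheorem8_general hS.zero_notMem hS.left_ore fun s _ =>
    hG.exists_leftAnnihilator_pow_succ_le s).mono_left fun _ hc => hc.2).inter_eq
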